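/- **Scaling formula.** Work on an open set $U$ (in the product topology) of the jet space with coordinates $(x,v,v_x,v_{xx},\ldots)$ of a real function $v(x)$. A *differential function* on $U$ is a smooth function of $x$ and finitely many of the coordinates $\partial_x^jv$. Let $D_x=\partial_x+\sum_{j\ge0}(\partial_x^{j+1}v)\,\partial_{\partial_x^jv}$ be the total derivative, and let $E_v(f)=\sum_{j\ge0}(-D_x)^j\big(\partial_{\partial_x^jv}f\big)$ be the Euler operator. Write $f\equiv g$ if $f-g=D_x\Phi$ on $U$ for some differential function $\Phi$ on $U$. A *Hamiltonian operator* $\mathcal H$ is a linear operator on differential functions, possibly integro-differential (only partially defined, and with values only up to integration constants), whose bracket $\{F,G\}=\int(\delta F/\delta v)\,\mathcal H(\delta G/\delta v)\,dx$ is skew and satisfies the Jacobi identity, where functionals are identified with their densities modulo $\equiv$. Consider a Hamiltonian evolution equation $$v_t=\mathcal H(Q),\qquad Q=\frac{\delta H}{\delta v}=E_v(h),\qquad H=\int h(x,v,v_x,\ldots)\,dx,$$ with $h$ a differential function on $U$. Let $a,b,c,p,q\in\mathbb R$. Suppose that $U$ is invariant under the prolonged scaling $x\to\lambda^ax$, $\partial_x^jv\to\lambda^{c-ja}\partial_x^jv$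 for all $\lambda>0$, that the equation is invariant under $x\to\lambda^ax$, $t\to\lambda^bt$, $v\to\lambda^cv$, and that its Hamiltonian structure is homogeneous, $h\to\lambda^ph$ and $\mathcal H\to\lambda^q\mathcal H$, with $p+q+b-2c=0$. If $p+a\neq0$, then $$h\equiv\frac{1}{p+a}\Big((c+a)\,vQ-a\,D_x^{-1}(v\,D_xQ)\Big)$$ in the following sense. 1. The formula holds with $D_x^{-1}(vD_xQ)$ replaced by any differential function $G$ on $U$ such that $D_xG=vD_xQ$. 2. If $h$ does not depend explicitly on $x$ ($\partial h/\partial x=0$ on $U$), such a $G$ exists. 3. If $a=0$, then $h\equiv\frac1p\,c\,vQ$, whether or not such a $G$ exists. 4. In all cases, if $w$ is adjoined as a new independent coordinate ranging over $\mathbb R$, with $D_xw=vD_xQ$ (that is, $D_x$ is extended to functions of $w,x,v,v_x,\ldots$ by adding the term $(vD_xQ)\,\partial_w$), then $$h-\frac{1}{p+a}\big((c+a)\,vQ-a\,w\big)=D_x\Psi\quad\text{on }U\times\mathbb R$$ for some smooth function $\Psi$ of $w$, $x$ and finitely many of the coordinates $\partial_x^jv$. -/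

import Mathlib

open scoped ContDiff

noncomputable section

/-- A point `(x, (v, v_x, v_xx, …))` of the infinite jet space of one real function `v` of one
real variable `x`; `z.2 j` is the coordinate `∂_x^j v`. It carries the product topology. -/
abbrev Jet : Type := ℝ × (ℕ → ℝ)

namespace Jet

/-- The projection to the jet coordinates `x, v, …, ∂_x^{k-1} v`. -/
def trunc (k : ℕ) (z : Jet) : ℝ × (Fin k → ℝ) := (z.1, fun i => z.2 i)

/-- Differential functions `f(x, v, v_x, …)` on a domain `U` of the jet space: smooth functions of
`x` and of finitely many of the coordinates `∂_x^j v`. Values outside `U` are irrelevant. -/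
def IsDiffFun (U : Set Jet) (f : Jet → ℝ) : Prop :=
  ∃ (k : ℕ) (F : ℝ × (Fin k → ℝ) → ℝ),
    ContDiffOn ℝ ∞ F (trunc k '' U) ∧ ∀ z ∈ U, f z = F (trunc k z)

/-- `∂f/∂x`, the partial derivative with respect to the explicit variable `x`. -/
def partialX (f : Jet → ℝ) (z : Jet) : ℝ := deriv (fun s => f (s, z.2)) z.1

/-- `∂f/∂(∂_x^j v)`. -/
def partialV (j : ℕ) (f : Jet → ℝ) (z : Jet) : ℝ :=
  deriv (fun s => f (z.1, Function.update z.2 j s)) (z.2 j)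

/-- The total derivative `D_x f = ∂_x f + v_x ∂_v f + v_xx ∂_{v_x} f + ⋯`
(a finite sum at the points of `U` if `f` is a differential function on the open set `U`). -/
def totalDeriv (f : Jet → ℝ) (z : Jet) : ℝ :=
  partialX f z + ∑ᶠ j : ℕ, z.2 (j + 1) * partialV j f z

/-- The Euler operator `E_v(f) = ∂_v f - D_x(∂_{v_x} f) + D_x²(∂_{v_xx} f) - ⋯`. -/
def euler (f : Jet → ℝ) (z : Jet) : ℝ :=
  ∑ᶠ j : ℕ, (-1 : ℝ) ^ j * (totalDeriv^[j] (partialV j f)) z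

/-- `f = D_x Φ` on `U` for some differential function `Φ` on `U`. -/
def IsTotalDeriv (U : Set Jet) (f : Jet → ℝ) : Prop :=
  ∃ Φ : Jet → ℝ, IsDiffFun U Φ ∧ ∀ z ∈ U, f z = totalDeriv Φ z

/-- `f ≡ g`: equality on `U` modulo total `x`-derivatives. -/
def EquivMod (U : Set Jet) (f g : Jet → ℝ) : Prop := IsTotalDeriv U (fun z => f z - g z)

/-- `g` is a value of `D_x⁻¹ f` in the differential functions on `U`. -/
def IsAntideriv (U : Set Jet) (f g : Jet → ℝ) : Prop :=
  IsDiffFun U g ∧ ∀ z ∈ U, totalDeriv g z = f z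

/-- The prolongation of the scaling `x → λ^a x`, `v → λ^c v` to the jet space:
`∂_x^j v → λ^(c - j a) ∂_x^j v`. -/
def scale (a c l : ℝ) (z : Jet) : Jet :=
  (l ^ a * z.1, fun j => l ^ (c - (j : ℝ) * a) * z.2 j)

/-- `f → λ^r f` under the scaling with weights `a`, `c`. -/
def IsHomogeneous (U : Set Jet) (a c r : ℝ) (f : Jet → ℝ) : Prop :=
  ∀ l : ℝ, 0 < l → ∀ z ∈ U, f (scale a c l z) = l ^ r * f z

/-- A Hamiltonian operator `𝓗` on differential functions: a linear operator whose bracket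
`{F, G} = ∫ (δF/δv) 𝓗(δG/δv) dx` is skew and satisfies the Jacobi identity, functionals being
represented by their densities modulo total `x`-derivatives.
The operator is given by its graph (`𝓗 f g` says that `g` is a value of `𝓗(f)`), so that besides
differential operators also integro-differential ones are allowed, such as
`-D_x³ - D_x v D_x⁻¹ v D_x`, which are defined only where `D_x⁻¹` can be carried out, and only
up to the integration constant. -/
structure IsHamiltonianOperator (U : Set Jet) (𝓗 : (Jet → ℝ) → (Jet → ℝ) → Prop) : Prop where
  diffFun : ∀ f g, 𝓗 f g → IsDiffFun U f ∧ IsDiffFun U g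
  congr : ∀ f g f' g', 𝓗 f g → Set.EqOn f f' U → Set.EqOn g g' U → 𝓗 f' g'
  map_zero : 𝓗 0 0
  map_add : ∀ f g f' g', 𝓗 f g → 𝓗 f' g' → 𝓗 (f + f') (g + g')
  map_smul : ∀ (s : ℝ) f g, 𝓗 f g → 𝓗 (s • f) (s • g)
  skew : ∀ f₁ f₂ P₁ P₂, IsDiffFun U f₁ → IsDiffFun U f₂ →
    𝓗 (euler f₁) P₁ → 𝓗 (euler f₂) P₂ →
    IsTotalDeriv U (euler f₁ * P₂ + euler f₂ * P₁)
  jacobi : ∀ f₁ f₂ f₃ P₁ P₂ P₃, IsDiffFun U f₁ → IsDiffFun U f₂ → IsDiffFun U f₃ →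
    𝓗 (euler f₁) P₁ → 𝓗 (euler f₂) P₂ → 𝓗 (euler f₃) P₃ →
    IsTotalDeriv U (euler (euler f₁ * P₂) * P₃ + euler (euler f₂ * P₃) * P₁
      + euler (euler f₃ * P₁) * P₂)

/-- The evolution equation `v_t = P` with `P = 𝓗(δH/δv)`, `H = ∫ h dx`, is a Hamiltonian evolution
equation on the domain `U` that is invariant under the scaling `x → λ^a x`, `t → λ^b t`,
`v → λ^c v`, with `h → λ^p h` and `𝓗 → λ^q 𝓗`. -/
structure IsScalingHamiltonianEq (U : Set Jet) (a b c p q : ℝ) (h : Jet → ℝ)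
    (𝓗 : (Jet → ℝ) → (Jet → ℝ) → Prop) (P : Jet → ℝ) : Prop where
  isOpen : IsOpen U
  scale_mem : ∀ l : ℝ, 0 < l → ∀ z ∈ U, scale a c l z ∈ U
  density : IsDiffFun U h
  hamiltonian : IsHamiltonianOperator U 𝓗
  equation : 𝓗 (euler h) P
  /-- `v_t = P` is mapped to itself, as `v_t → λ^(c-b) v_t`. -/
  invariant : IsHomogeneous U a c (c - b) P
  density_weight : IsHomogeneous U a c p h
  /-- The scaling turns `𝓗` into `λ^q 𝓗`: if `g = 𝓗(f)` then, after scaling, `g = λ^q 𝓗(f)`. -/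
  operator_weight : ∀ l : ℝ, 0 < l → ∀ f g, 𝓗 f g →
    𝓗 (fun z => f (scale a c l z)) (fun z => l ^ (-q) * g (scale a c l z))
  weights : p + q + b - 2 * c = 0

/-! Nonlocal expressions with one potential `w`, a new coordinate with `D_x w = R`. They give
`D_x⁻¹ R` a meaning also where `R` is not the total derivative of a differential function. -/

/-- Smooth functions of `w`, `x` and finitely many of the coordinates `∂_x^j v`, on `U × ℝ`. -/
def IsDiffFunPot (U : Set Jet) (Ψ : Jet × ℝ → ℝ) : Prop :=
  ∃ (k : ℕ) (F : (ℝ × (Fin k → ℝ)) × ℝ → ℝ),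
    ContDiffOn ℝ ∞ F ((trunc k '' U) ×ˢ Set.univ) ∧
      ∀ z ∈ U, ∀ w : ℝ, Ψ (z, w) = F (trunc k z, w)

/-- The total derivative `D_x` extended by `D_x w = R`. -/
def totalDerivPot (R : Jet → ℝ) (Ψ : Jet × ℝ → ℝ) (y : Jet × ℝ) : ℝ :=
  totalDeriv (fun z => Ψ (z, y.2)) y.1 + R y.1 * deriv (fun s => Ψ (y.1, s)) y.2

/-- `f ≡ g` modulo total `x`-derivatives of expressions in `x, v, v_x, …` and `w = D_x⁻¹ R`. -/
def EquivModPot (U : Set Jet) (R : Jet → ℝ) (f g : Jet × ℝ → ℝ) : Prop :=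
  ∃ Ψ : Jet × ℝ → ℝ, IsDiffFunPot U Ψ ∧
    ∀ z ∈ U, ∀ w : ℝ, f (z, w) - g (z, w) = totalDerivPot R Ψ (z, w)

end Jet

end

open scoped ContDiff Topology
open Filter

namespace Jet

/-! Representations of differential functions and their derivatives along curves. -/

/-! Let `η = c v - a x v_x` be the characteristic of the scaling, so that `D_x^j η = (c - ja) v_j -
a x v_{j+1}`. By Euler's identity for `h`, the prolonged field of `η` sends `h` to `p h - a x D_x
h`, which is `(p + a) h` minus `D_x(a x h)`. Integration by parts
(`Represents.isTotalDeriv_prolongation_sub`) shows that it also sends `h` to `η Q` modulo total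
derivatives. Moving `D_x` off `v` in `-a x v_x Q` yields `(p + a) h ≡ (c + a) v Q + a x v D_x Q`
(`IsDiffFun.isTotalDeriv_of_isHomogeneous`). If `D_x G = v D_x Q`, the last term is `a D_x(x G) - a
G`; a potential `w` serves equally well in place of `G`. The same integration by parts with the
translation characteristic `v_x` constructs `G` when `∂h/∂x = 0`. -/

theorem isOpen_trunc_image {U : Set Jet} (hU : IsOpen U) (k : ℕ) : IsOpen (trunc k '' U) := by
  rw [isOpen_iff_mem_nhds]
  rintro _ ⟨z, hz, rfl⟩
  -- A continuous right inverse of `trunc k` through `z`: the missing coordinates are frozen at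
  -- those of `z`.
  let σ : ℝ × (Fin k → ℝ) → Jet :=
    fun p => (p.1, fun j => if hj : j < k then p.2 ⟨j, hj⟩ else z.2 j)
  have hσ : Continuous σ := by
    refine continuous_fst.prodMk (continuous_pi fun j => ?_)
    by_cases hj : j < k
    · simp only [hj, dite_true]; fun_prop
    · simp only [hj, dite_false]; fun_prop
  have hσz : σ (trunc k z) = z := by
    refine Prod.ext rfl (funext fun j => ?_)
    by_cases hj : j < k <;> simp [σ, trunc, hj]
  have hmem : σ ⁻¹' U ∈ 𝓝 (trunc k z) :=
    hσ.continuousAt.preimage_mem_nhds (by rw [hσz]; exact hU.mem_nhds hz)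
  refine mem_of_superset hmem fun p hp => ⟨σ p, hp, ?_⟩
  refine Prod.ext rfl (funext fun i => ?_)
  simp [σ, trunc]

/-- `F` represents `f` on `U` as a smooth function of `x, v, …, ∂_x^{k-1} v`. -/
def Represents (U : Set Jet) (k : ℕ) (F : ℝ × (Fin k → ℝ) → ℝ) (f : Jet → ℝ) : Prop :=
  ContDiffOn ℝ ∞ F (trunc k '' U) ∧ ∀ z ∈ U, f z = F (trunc k z)

theorem Represents.isDiffFun {U : Set Jet} {k : ℕ} {F : ℝ × (Fin k → ℝ) → ℝ} {f : Jet → ℝ}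
    (h : Represents U k F f) : IsDiffFun U f := ⟨k, F, h⟩

theorem Represents.exists_of_le {U : Set Jet} {k m : ℕ} {F : ℝ × (Fin k → ℝ) → ℝ} {f : Jet → ℝ}
    (h : Represents U k F f) (hkm : k ≤ m) : ∃ F', Represents U m F' f := by
  refine ⟨fun p => F (p.1, fun i => p.2 (Fin.castLE hkm i)), h.1.comp (by fun_prop) ?_, h.2⟩
  rintro _ ⟨z, hz, rfl⟩
  exact ⟨z, hz, rfl⟩

/-- All derivatives of differential functions reduce to this chain rule. Differentiability of the
curve is needed only after truncation; in the jet space continuity suffices, to keep the curve in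
`U`. -/
theorem Represents.hasDerivAt_comp {U : Set Jet} (hU : IsOpen U) {k : ℕ}
    {F : ℝ × (Fin k → ℝ) → ℝ} {f : Jet → ℝ} (h : Represents U k F f) {γ : ℝ → Jet} {s : ℝ}
    {w : ℝ × (Fin k → ℝ)} (hγ : ContinuousAt γ s) (hs : γ s ∈ U)
    (hw : HasDerivAt (fun t => trunc k (γ t)) w s) :
    HasDerivAt (fun t => f (γ t)) (fderiv ℝ F (trunc k (γ s)) w) s := by
  have hF : DifferentiableAt ℝ F (trunc k (γ s)) :=
    (h.1.contDiffAt ((isOpen_trunc_image hU k).mem_nhds ⟨_, hs, rfl⟩)).differentiableAt (by simp)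
  refine (hF.hasFDerivAt.comp_hasDerivAt s hw).congr_of_eventuallyEq ?_
  filter_upwards [hγ.preimage_mem_nhds (hU.mem_nhds hs)] with t ht
  exact h.2 _ ht

theorem Represents.hasDerivAt_x {U : Set Jet} (hU : IsOpen U) {k : ℕ}
    {F : ℝ × (Fin k → ℝ) → ℝ} {f : Jet → ℝ} (h : Represents U k F f) {z : Jet} (hz : z ∈ U) :
    HasDerivAt (fun s => f (s, z.2)) (fderiv ℝ F (trunc k z) (1, 0)) z.1 :=
  h.hasDerivAt_comp hU (γ := fun s => (s, z.2)) (by fun_prop) hz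
    ((hasDerivAt_id z.1).prodMk (hasDerivAt_const z.1 fun i : Fin k => z.2 i))

theorem Represents.partialX_eq {U : Set Jet} (hU : IsOpen U) {k : ℕ}
    {F : ℝ × (Fin k → ℝ) → ℝ} {f : Jet → ℝ} (h : Represents U k F f) {z : Jet} (hz : z ∈ U) :
    partialX f z = fderiv ℝ F (trunc k z) (1, 0) :=
  (h.hasDerivAt_x hU hz).deriv

theorem Represents.partialV_eq {U : Set Jet} (hU : IsOpen U) {k : ℕ}
    {F : ℝ × (Fin k → ℝ) → ℝ} {f : Jet → ℝ} (h : Represents U k F f) (j : ℕ) {z : Jet}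
    (hz : z ∈ U) :
    partialV j f z = fderiv ℝ F (trunc k z) (0, fun i => if (i : ℕ) = j then 1 else 0) := by
  have hupd : Function.update z.2 j (z.2 j) = z.2 := Function.update_eq_self j z.2
  have key := h.hasDerivAt_comp hU (γ := fun s => (z.1, Function.update z.2 j s)) (s := z.2 j)
    (w := (0, fun i => if (i : ℕ) = j then 1 else 0)) (by fun_prop)
    (by rw [hupd]; exact hz) ?_
  · rw [hupd] at key
    exact key.deriv
  · refine (hasDerivAt_const _ _).prodMk (hasDerivAt_pi.2 fun i => ?_)
    by_cases hi : (i : ℕ) = j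
    · simpa [Function.update_apply, hi] using hasDerivAt_id' (z.2 j)
    · simpa [Function.update_apply, hi] using hasDerivAt_const (z.2 j) (z.2 i)

theorem Represents.partialV_eq_zero {U : Set Jet} (hU : IsOpen U) {k : ℕ}
    {F : ℝ × (Fin k → ℝ) → ℝ} {f : Jet → ℝ} (h : Represents U k F f) {j : ℕ} (hj : k ≤ j)
    {z : Jet} (hz : z ∈ U) : partialV j f z = 0 := by
  have h0 : (fun i : Fin k => if (i : ℕ) = j then (1 : ℝ) else 0) = 0 := by
    ext i
    simp [(i.2.trans_le hj).ne]
  rw [h.partialV_eq hU j hz, h0]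
  exact map_zero _

theorem Represents.fderiv_apply {U : Set Jet} (hU : IsOpen U) {k : ℕ}
    {F : ℝ × (Fin k → ℝ) → ℝ} {f : Jet → ℝ} (h : Represents U k F f) {z : Jet} (hz : z ∈ U)
    (r : ℝ) (u : ℕ → ℝ) :
    fderiv ℝ F (trunc k z) (r, fun i => u i)
      = r * partialX f z + ∑ j ∈ Finset.range k, u j * partialV j f z := by
  have hdec : ((r, fun i => u i) : ℝ × (Fin k → ℝ)) = r • ((1, 0) : ℝ × (Fin k → ℝ))
      + ∑ j ∈ Finset.range k,
        u j • ((0, fun i => if (i : ℕ) = j then 1 else 0) : ℝ × (Fin k → ℝ)) := by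
    refine Prod.ext ?_ (funext fun i => ?_)
    · simp [Prod.fst_sum]
    · simp [Prod.snd_sum, Finset.sum_apply]
  rw [hdec, map_add, map_sum, map_smul, h.partialX_eq hU hz]
  simp only [map_smul, smul_eq_mul, h.partialV_eq hU _ hz]

theorem Represents.totalDeriv_eq_sum {U : Set Jet} (hU : IsOpen U) {k : ℕ}
    {F : ℝ × (Fin k → ℝ) → ℝ} {f : Jet → ℝ} (h : Represents U k F f) {z : Jet} (hz : z ∈ U) :
    totalDeriv f z = partialX f z + ∑ j ∈ Finset.range k, z.2 (j + 1) * partialV j f z := by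
  rw [totalDeriv, finsum_eq_sum_of_support_subset]
  intro j hj
  by_contra hjk
  exact hj (by simp [h.partialV_eq_zero hU (by simpa using hjk) hz])

theorem Represents.totalDeriv_eq {U : Set Jet} (hU : IsOpen U) {k : ℕ}
    {F : ℝ × (Fin k → ℝ) → ℝ} {f : Jet → ℝ} (h : Represents U k F f) {z : Jet} (hz : z ∈ U) :
    totalDeriv f z = fderiv ℝ F (trunc k z) (1, fun i => z.2 (i + 1)) := by
  rw [h.totalDeriv_eq_sum hU hz, h.fderiv_apply hU hz 1 fun j => z.2 (j + 1), one_mul]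

theorem IsDiffFun.partialV {U : Set Jet} (hU : IsOpen U) {f : Jet → ℝ} (hf : IsDiffFun U f)
    (j : ℕ) : IsDiffFun U (partialV j f) := by
  obtain ⟨k, F, h⟩ := hf
  exact ⟨k, fun p => fderiv ℝ F p (0, fun i => if (i : ℕ) = j then 1 else 0),
    (h.1.fderiv_of_isOpen (isOpen_trunc_image hU k) (by simp)).clm_apply contDiffOn_const,
    fun z hz => Represents.partialV_eq hU h j hz⟩

theorem IsDiffFun.totalDeriv {U : Set Jet} (hU : IsOpen U) {f : Jet → ℝ} (hf : IsDiffFun U f) :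
    IsDiffFun U (totalDeriv f) := by
  obtain ⟨k, F, h⟩ := hf
  have hfd : ContDiffOn ℝ ∞ (fderiv ℝ F) (trunc k '' U) :=
    h.1.fderiv_of_isOpen (isOpen_trunc_image hU k) (by simp)
  -- `D_x` raises the order by one, hence one more coordinate.
  refine ⟨k + 1, fun p => fderiv ℝ F (p.1, fun i => p.2 i.castSucc) (1, fun i => p.2 i.succ),
    ContDiffOn.clm_apply (hfd.comp (t := trunc k '' U)
      (f := fun p : ℝ × (Fin (k + 1) → ℝ) => (p.1, fun i : Fin k => p.2 i.castSucc))
      (by fun_prop) ?_) (by fun_prop), fun z hz => Represents.totalDeriv_eq hU h hz⟩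
  rintro _ ⟨z, hz, rfl⟩
  exact ⟨z, hz, rfl⟩

theorem IsDiffFun.iterate_totalDeriv {U : Set Jet} (hU : IsOpen U) {f : Jet → ℝ}
    (hf : IsDiffFun U f) (j : ℕ) : IsDiffFun U (Jet.totalDeriv^[j] f) := by
  induction j with
  | zero => exact hf
  | succ j ih => rw [Function.iterate_succ_apply']; exact ih.totalDeriv hU

/-- The total derivative is the derivative along the line with direction `(1, v_x, v_xx, …)`. -/
theorem IsDiffFun.hasDerivAt_line {U : Set Jet} (hU : IsOpen U) {f : Jet → ℝ}
    (hf : IsDiffFun U f) {z : Jet} (hz : z ∈ U) :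
    HasDerivAt (fun s : ℝ => f (z.1 + s, fun j => z.2 j + s * z.2 (j + 1)))
      (Jet.totalDeriv f z) 0 := by
  obtain ⟨k, F, h⟩ := hf
  have hz0 : ((z.1 + 0, fun j => z.2 j + 0 * z.2 (j + 1)) : Jet) = z := by simp
  have key := Represents.hasDerivAt_comp hU h
    (γ := fun s : ℝ => (z.1 + s, fun j => z.2 j + s * z.2 (j + 1))) (s := 0)
    (w := (1, fun i => z.2 (i + 1))) (by fun_prop) (by rw [hz0]; exact hz) ?_
  · rw [hz0] at key
    rwa [Represents.totalDeriv_eq hU h hz]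
  · refine ((hasDerivAt_id (0 : ℝ)).const_add z.1).prodMk (hasDerivAt_pi.2 fun i => ?_)
    simpa using ((hasDerivAt_id (0 : ℝ)).mul_const (z.2 (i + 1))).const_add (z.2 i)

/-! The algebra of differential functions. -/

theorem IsDiffFun.congr {U : Set Jet} {f g : Jet → ℝ} (hf : IsDiffFun U f) (hfg : Set.EqOn g f U) :
    IsDiffFun U g := by
  obtain ⟨k, F, h⟩ := hf
  exact ⟨k, F, h.1, fun z hz => (hfg hz).trans (h.2 z hz)⟩

theorem isDiffFun_const (U : Set Jet) (r : ℝ) : IsDiffFun U fun _ => r :=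
  ⟨0, fun _ => r, contDiffOn_const, fun _ _ => rfl⟩

theorem isDiffFun_x (U : Set Jet) : IsDiffFun U fun z => z.1 :=
  ⟨0, fun p => p.1, contDiff_fst.contDiffOn, fun _ _ => rfl⟩

theorem isDiffFun_v (U : Set Jet) (j : ℕ) : IsDiffFun U fun z => z.2 j :=
  ⟨j + 1, fun p => p.2 (Fin.last j), by fun_prop, fun _ _ => rfl⟩

theorem IsDiffFun.exists_represents {U : Set Jet} {f g : Jet → ℝ} (hf : IsDiffFun U f)
    (hg : IsDiffFun U g) : ∃ k F G, Represents U k F f ∧ Represents U k G g := by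
  obtain ⟨k, F, hF⟩ := hf
  obtain ⟨m, G, hG⟩ := hg
  obtain ⟨F', hF'⟩ := Represents.exists_of_le hF (le_max_left k m)
  obtain ⟨G', hG'⟩ := Represents.exists_of_le hG (le_max_right k m)
  exact ⟨_, F', G', hF', hG'⟩

theorem IsDiffFun.add {U : Set Jet} {f g : Jet → ℝ} (hf : IsDiffFun U f) (hg : IsDiffFun U g) :
    IsDiffFun U fun z => f z + g z := by
  obtain ⟨k, F, G, hF, hG⟩ := hf.exists_represents hg
  exact ⟨k, fun p => F p + G p, hF.1.add hG.1, fun z hz => by simp only [hF.2 z hz, hG.2 z hz]⟩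

theorem IsDiffFun.mul {U : Set Jet} {f g : Jet → ℝ} (hf : IsDiffFun U f) (hg : IsDiffFun U g) :
    IsDiffFun U fun z => f z * g z := by
  obtain ⟨k, F, G, hF, hG⟩ := hf.exists_represents hg
  exact ⟨k, fun p => F p * G p, hF.1.mul hG.1, fun z hz => by simp only [hF.2 z hz, hG.2 z hz]⟩

theorem IsDiffFun.const_mul {U : Set Jet} {f : Jet → ℝ} (r : ℝ) (hf : IsDiffFun U f) :
    IsDiffFun U fun z => r * f z :=
  (isDiffFun_const U r).mul hf

theorem IsDiffFun.sub {U : Set Jet} {f g : Jet → ℝ} (hf : IsDiffFun U f) (hg : IsDiffFun U g) :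
    IsDiffFun U fun z => f z - g z :=
  (hf.add (hg.const_mul (-1))).congr fun z _ => by ring

theorem IsDiffFun.sum {U : Set Jet} {f : ℕ → Jet → ℝ} (hf : ∀ j, IsDiffFun U (f j)) (k : ℕ) :
    IsDiffFun U fun z => ∑ j ∈ Finset.range k, f j z := by
  induction k with
  | zero => simpa using isDiffFun_const U 0
  | succ k ih => simpa only [Finset.sum_range_succ] using ih.add (hf k)

/-! Rules for the total derivative. -/

/-- Since `U` is open, the line through a point of `U` stays in `U` for small `s`. Iterates of `D_x`
need this because formulas are known only on `U`. -/
theorem totalDeriv_congr {U : Set Jet} (hU : IsOpen U) {f g : Jet → ℝ} (hf : IsDiffFun U f)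
    (hfg : Set.EqOn g f U) : Set.EqOn (totalDeriv g) (totalDeriv f) U := by
  intro z hz
  refine ((hf.congr hfg).hasDerivAt_line hU hz).unique
    ((hf.hasDerivAt_line hU hz).congr_of_eventuallyEq ?_)
  have hγ : ContinuousAt
      (fun s : ℝ => ((z.1 + s, fun j => z.2 j + s * z.2 (j + 1)) : Jet)) 0 := by fun_prop
  filter_upwards [hγ.preimage_mem_nhds (hU.mem_nhds (by simpa using hz))] with s hs
  exact hfg hs

theorem iterate_totalDeriv_congr {U : Set Jet} (hU : IsOpen U) {f g : Jet → ℝ}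
    (hf : IsDiffFun U f) (hfg : Set.EqOn g f U) (j : ℕ) :
    Set.EqOn (totalDeriv^[j] g) (totalDeriv^[j] f) U := by
  induction j with
  | zero => exact hfg
  | succ j ih =>
    simp only [Function.iterate_succ_apply']
    exact totalDeriv_congr hU (hf.iterate_totalDeriv hU j) ih

theorem totalDeriv_add {U : Set Jet} (hU : IsOpen U) {f g : Jet → ℝ} (hf : IsDiffFun U f)
    (hg : IsDiffFun U g) {z : Jet} (hz : z ∈ U) :
    totalDeriv (fun z => f z + g z) z = totalDeriv f z + totalDeriv g z :=
  ((hf.add hg).hasDerivAt_line hU hz).unique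
    ((hf.hasDerivAt_line hU hz).add (hg.hasDerivAt_line hU hz))

theorem totalDeriv_sub {U : Set Jet} (hU : IsOpen U) {f g : Jet → ℝ} (hf : IsDiffFun U f)
    (hg : IsDiffFun U g) {z : Jet} (hz : z ∈ U) :
    totalDeriv (fun z => f z - g z) z = totalDeriv f z - totalDeriv g z :=
  ((hf.sub hg).hasDerivAt_line hU hz).unique
    ((hf.hasDerivAt_line hU hz).sub (hg.hasDerivAt_line hU hz))

theorem totalDeriv_mul {U : Set Jet} (hU : IsOpen U) {f g : Jet → ℝ} (hf : IsDiffFun U f)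
    (hg : IsDiffFun U g) {z : Jet} (hz : z ∈ U) :
    totalDeriv (fun z => f z * g z) z = totalDeriv f z * g z + f z * totalDeriv g z := by
  have := (hf.hasDerivAt_line hU hz).mul (hg.hasDerivAt_line hU hz)
  simpa using ((hf.mul hg).hasDerivAt_line hU hz).unique this

theorem totalDeriv_const_mul {U : Set Jet} (hU : IsOpen U) (r : ℝ) {f : Jet → ℝ}
    (hf : IsDiffFun U f) {z : Jet} (hz : z ∈ U) :
    totalDeriv (fun z => r * f z) z = r * totalDeriv f z :=
  ((hf.const_mul r).hasDerivAt_line hU hz).unique ((hf.hasDerivAt_line hU hz).const_mul r)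

theorem totalDeriv_x {U : Set Jet} (hU : IsOpen U) {z : Jet} (hz : z ∈ U) :
    totalDeriv (fun z => z.1) z = 1 :=
  ((isDiffFun_x U).hasDerivAt_line hU hz).unique ((hasDerivAt_id (0 : ℝ)).const_add z.1)

theorem totalDeriv_v {U : Set Jet} (hU : IsOpen U) (j : ℕ) {z : Jet} (hz : z ∈ U) :
    totalDeriv (fun z => z.2 j) z = z.2 (j + 1) := by
  refine ((isDiffFun_v U j).hasDerivAt_line hU hz).unique ?_
  simpa using ((hasDerivAt_id (0 : ℝ)).mul_const (z.2 (j + 1))).const_add (z.2 j)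

/-! ### Finiteness of the Euler operator. -/

theorem iterate_totalDeriv_eq_zero {U : Set Jet} (hU : IsOpen U) {f : Jet → ℝ}
    (hf : ∀ z ∈ U, f z = 0) (j : ℕ) {z : Jet} (hz : z ∈ U) : totalDeriv^[j] f z = 0 := by
  have h0 : ∀ n : ℕ, Set.EqOn (totalDeriv^[n] fun _ => (0 : ℝ)) (fun _ => 0) U := by
    intro n
    induction n with
    | zero => exact fun _ _ => rfl
    | succ n ih =>
      intro y hy
      rw [Function.iterate_succ_apply', totalDeriv_congr hU (isDiffFun_const U 0) ih hy]
      simpa using totalDeriv_const_mul hU 0 (isDiffFun_const U 0) hy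
  rw [iterate_totalDeriv_congr hU (isDiffFun_const U 0) hf j hz, h0 j hz]

theorem Represents.euler_eq_sum {U : Set Jet} (hU : IsOpen U) {k : ℕ}
    {F : ℝ × (Fin k → ℝ) → ℝ} {f : Jet → ℝ} (h : Represents U k F f) {z : Jet} (hz : z ∈ U) :
    euler f z = ∑ j ∈ Finset.range k, (-1 : ℝ) ^ j * totalDeriv^[j] (partialV j f) z := by
  rw [euler, finsum_eq_sum_of_support_subset]
  intro j hj
  by_contra hjk
  refine hj ?_
  have hz0 := iterate_totalDeriv_eq_zero hU
    (fun y hy => h.partialV_eq_zero hU (j := j) (by simpa using hjk) hy) j hz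
  simp only [hz0, mul_zero]

theorem IsDiffFun.euler {U : Set Jet} (hU : IsOpen U) {f : Jet → ℝ} (hf : IsDiffFun U f) :
    IsDiffFun U (euler f) := by
  obtain ⟨k, F, h⟩ := id hf
  exact (IsDiffFun.sum (fun j => ((hf.partialV hU j).iterate_totalDeriv hU j).const_mul
    ((-1 : ℝ) ^ j)) k).congr fun z hz => Represents.euler_eq_sum hU h hz

/-! Integration by parts. -/

theorem IsTotalDeriv.sum {U : Set Jet} (hU : IsOpen U) {f : ℕ → Jet → ℝ}
    (hf : ∀ j, IsTotalDeriv U (f j)) (k : ℕ) :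
    IsTotalDeriv U fun z => ∑ j ∈ Finset.range k, f j z := by
  choose Φ hΦ hD using hf
  refine ⟨fun z => ∑ j ∈ Finset.range k, Φ j z, IsDiffFun.sum hΦ k, fun z hz => ?_⟩
  refine HasDerivAt.unique ?_ ((IsDiffFun.sum hΦ k).hasDerivAt_line hU hz)
  simpa only [hD _ z hz] using
    HasDerivAt.fun_sum (u := Finset.range k) fun j _ => (hΦ j).hasDerivAt_line hU hz

/-- One derivative is moved at a time: `D_x^{j+1} f · g = D_x(D_x^j f · g) - D_x^j f · D_x g`, with
the induction hypothesis applied to `D_x g`. -/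
theorem isTotalDeriv_iterate_mul_sub {U : Set Jet} (hU : IsOpen U) (j : ℕ) {f g : Jet → ℝ}
    (hf : IsDiffFun U f) (hg : IsDiffFun U g) :
    IsTotalDeriv U fun z =>
      totalDeriv^[j] f z * g z - f z * ((-1 : ℝ) ^ j * totalDeriv^[j] g z) := by
  induction j generalizing g with
  | zero =>
    -- Zero is written as a product so that the constant-multiple rule differentiates it.
    refine ⟨fun _ => 0 * 0, (isDiffFun_const U 0).mul (isDiffFun_const U 0), fun z hz => ?_⟩
    rw [totalDeriv_const_mul hU 0 (isDiffFun_const U 0) hz]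
    simp
  | succ j ih =>
    obtain ⟨Φ, hΦ, hD⟩ := ih (hg.totalDeriv hU)
    have hfj := hf.iterate_totalDeriv hU j
    refine ⟨fun z => totalDeriv^[j] f z * g z - Φ z, (hfj.mul hg).sub hΦ, fun z hz => ?_⟩
    rw [totalDeriv_sub hU (hfj.mul hg) hΦ hz, totalDeriv_mul hU hfj hg hz, ← hD z hz,
      Function.iterate_succ_apply', Function.iterate_succ_apply]
    ring

/-- The prolonged evolutionary vector field with characteristic `η` acts on `f` as multiplication
of the Euler operator by `η`, up to total derivatives. -/
theorem Represents.isTotalDeriv_prolongation_sub {U : Set Jet} (hU : IsOpen U) {k : ℕ}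
    {F : ℝ × (Fin k → ℝ) → ℝ} {f η : Jet → ℝ} (h : Represents U k F f) (hη : IsDiffFun U η) :
    IsTotalDeriv U fun z =>
      (∑ j ∈ Finset.range k, totalDeriv^[j] η z * partialV j f z) - η z * euler f z := by
  obtain ⟨Φ, hΦ, hD⟩ := IsTotalDeriv.sum hU (fun j =>
    isTotalDeriv_iterate_mul_sub hU j hη (h.isDiffFun.partialV hU j)) k
  refine ⟨Φ, hΦ, fun z hz => ?_⟩
  rw [← hD z hz]
  beta_reduce
  rw [h.euler_eq_sum hU hz, Finset.mul_sum, Finset.sum_sub_distrib]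

/-! Scaling. -/

/-- Euler's identity for homogeneous differential functions. -/
theorem Represents.euler_identity {U : Set Jet} (hU : IsOpen U) {k : ℕ}
    {F : ℝ × (Fin k → ℝ) → ℝ} {f : Jet → ℝ} (h : Represents U k F f) {a c p : ℝ}
    (hhom : IsHomogeneous U a c p f) {z : Jet} (hz : z ∈ U) :
    p * f z = a * z.1 * partialX f z
      + ∑ j ∈ Finset.range k, (c - j * a) * z.2 j * partialV j f z := by
  have hpow : ∀ r : ℝ, HasDerivAt (fun l : ℝ => l ^ r) r 1 := fun r => by
    simpa using Real.hasDerivAt_rpow_const (x := 1) (p := r) (Or.inl one_ne_zero)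
  have hone : scale a c 1 z = z := by simp [scale]
  -- The homogeneity relation is differentiated in `l` at `l = 1`.
  have hcont : ContinuousAt (fun l : ℝ => scale a c l z) 1 :=
    ((hpow a).mul_const z.1).continuousAt.prodMk
      (continuousAt_pi.2 fun j => ((hpow (c - j * a)).mul_const (z.2 j)).continuousAt)
  have key := h.hasDerivAt_comp hU hcont (w := (a * z.1, fun i => (c - (i : ℕ) * a) * z.2 i))
    (by rw [hone]; exact hz)
    (((hpow a).mul_const z.1).prodMk
      (hasDerivAt_pi.2 fun i => (hpow (c - (i : ℕ) * a)).mul_const (z.2 i)))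
  rw [hone, h.fderiv_apply hU hz _ fun j => (c - j * a) * z.2 j] at key
  refine HasDerivAt.unique (((hpow p).mul_const (f z)).congr_of_eventuallyEq ?_) key
  filter_upwards [lt_mem_nhds one_pos] with l hl
  exact hhom l hl z hz

theorem iterate_totalDeriv_v {U : Set Jet} (hU : IsOpen U) (i j : ℕ) :
    Set.EqOn (totalDeriv^[j] fun z => z.2 i) (fun z => z.2 (i + j)) U := by
  induction j with
  | zero => exact fun _ _ => rfl
  | succ j ih =>
    intro z hz
    rw [Function.iterate_succ_apply', totalDeriv_congr hU (isDiffFun_v U (i + j)) ih hz,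
      totalDeriv_v hU _ hz]
    rfl

theorem isDiffFun_scaling_characteristic (U : Set Jet) (a r : ℝ) (j : ℕ) :
    IsDiffFun U fun z => r * z.2 j - a * (z.1 * z.2 (j + 1)) :=
  ((isDiffFun_v U j).const_mul r).sub (((isDiffFun_x U).mul (isDiffFun_v U (j + 1))).const_mul a)

/-- Each `D_x` hits the factor `x` once, which lowers the coefficient of `v_j` by `a`. -/
theorem iterate_totalDeriv_scaling_characteristic {U : Set Jet} (hU : IsOpen U) (a c : ℝ)
    (j : ℕ) : Set.EqOn (totalDeriv^[j] fun z => c * z.2 0 - a * (z.1 * z.2 1))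
      (fun z => (c - j * a) * z.2 j - a * (z.1 * z.2 (j + 1))) U := by
  induction j with
  | zero => intro z _; simp
  | succ j ih =>
    intro z hz
    rw [Function.iterate_succ_apply',
      totalDeriv_congr hU (isDiffFun_scaling_characteristic U a (c - j * a) j) ih hz,
      totalDeriv_sub hU ((isDiffFun_v U j).const_mul _)
        (((isDiffFun_x U).mul (isDiffFun_v U (j + 1))).const_mul a) hz,
      totalDeriv_const_mul hU _ (isDiffFun_v U j) hz,
      totalDeriv_const_mul hU _ ((isDiffFun_x U).mul (isDiffFun_v U (j + 1))) hz,
      totalDeriv_mul hU (isDiffFun_x U) (isDiffFun_v U (j + 1)) hz,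
      totalDeriv_x hU hz, totalDeriv_v hU _ hz, totalDeriv_v hU _ hz]
    push_cast
    ring

/-- Integrated form of the scaling formula, before an antiderivative of `v D_x Q` is chosen. -/
theorem IsDiffFun.isTotalDeriv_of_isHomogeneous {U : Set Jet} (hU : IsOpen U) {f : Jet → ℝ}
    (hf : IsDiffFun U f) {a c p : ℝ} (hhom : IsHomogeneous U a c p f) :
    IsTotalDeriv U fun z => (p + a) * f z - (c + a) * (z.2 0 * Jet.euler f z)
      - a * (z.1 * (z.2 0 * Jet.totalDeriv (Jet.euler f) z)) := by
  obtain ⟨k, F, h⟩ := id hf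
  obtain ⟨Φ, hΦ, hD⟩ := Represents.isTotalDeriv_prolongation_sub hU h
    (isDiffFun_scaling_characteristic U a c 0)
  have hx := isDiffFun_x U
  have hQ := hf.euler hU
  have hv := isDiffFun_v U 0
  have hvQ := hv.mul hQ
  have hxf := hx.mul (hf.sub hvQ)
  -- The boundary term `a x f` absorbs `-a x D_x f`, and `-a x v Q` comes from moving `D_x` off `v`
  -- in `x v_x Q`.
  refine ⟨fun z => Φ z + a * (z.1 * (f z - z.2 0 * Jet.euler f z)),
    hΦ.add (hxf.const_mul a), fun z hz => ?_⟩
  rw [totalDeriv_add hU hΦ (hxf.const_mul a) hz, totalDeriv_const_mul hU a hxf hz,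
    totalDeriv_mul hU hx (hf.sub hvQ) hz, totalDeriv_sub hU hf hvQ hz,
    totalDeriv_mul hU hv hQ hz, totalDeriv_x hU hz, totalDeriv_v hU 0 hz, ← hD z hz]
  have hsum : ∑ j ∈ Finset.range k, Jet.totalDeriv^[j]
        (fun z => c * z.2 0 - a * (z.1 * z.2 (0 + 1))) z * Jet.partialV j f z
      = (∑ j ∈ Finset.range k, (c - j * a) * z.2 j * Jet.partialV j f z)
        - a * z.1 * ∑ j ∈ Finset.range k, z.2 (j + 1) * Jet.partialV j f z := by
    rw [Finset.mul_sum, ← Finset.sum_sub_distrib]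
    refine Finset.sum_congr rfl fun j _ => ?_
    rw [iterate_totalDeriv_scaling_characteristic hU a c j hz]
    ring
  have heul := Represents.euler_identity hU h hhom hz
  have htot := Represents.totalDeriv_eq_sum hU h hz
  beta_reduce
  rw [hsum]
  linear_combination heul - a * z.1 * htot

/-- The density of a translation invariant functional provides an antiderivative of `v D_x Q`. -/
theorem IsDiffFun.exists_isAntideriv_of_partialX_eq_zero {U : Set Jet} (hU : IsOpen U)
    {f : Jet → ℝ} (hf : IsDiffFun U f) (hfx : ∀ z ∈ U, partialX f z = 0) :
    ∃ G, IsAntideriv U (fun z => z.2 0 * Jet.totalDeriv (Jet.euler f) z) G := by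
  obtain ⟨k, F, h⟩ := id hf
  obtain ⟨Φ, hΦ, hD⟩ := Represents.isTotalDeriv_prolongation_sub hU h (isDiffFun_v U 1)
  have hQ := hf.euler hU
  have hv := isDiffFun_v U 0
  have hvQ := hv.mul hQ
  -- Without explicit `x`, the prolongation of `v_x` acts on `f` as `D_x`, so `D_x Φ = D_x f - v_x
  -- Q`; then `v D_x Q = D_x(v Q) - v_x Q`.
  refine ⟨fun z => z.2 0 * Jet.euler f z - f z + Φ z, (hvQ.sub hf).add hΦ, fun z hz => ?_⟩
  rw [totalDeriv_add hU (hvQ.sub hf) hΦ hz, totalDeriv_sub hU hvQ hf hz,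
    totalDeriv_mul hU hv hQ hz, totalDeriv_v hU 0 hz, ← hD z hz,
    Represents.totalDeriv_eq_sum hU h hz, hfx z hz]
  have hsum : ∑ j ∈ Finset.range k, Jet.totalDeriv^[j] (fun z => z.2 1) z * Jet.partialV j f z
      = ∑ j ∈ Finset.range k, z.2 (j + 1) * Jet.partialV j f z :=
    Finset.sum_congr rfl fun j _ => by rw [iterate_totalDeriv_v hU 1 j hz, add_comm 1 j]
  beta_reduce
  rw [hsum, zero_add]
  ring

end Jet

/-- The scaling formula `h ≡ ((c + a) v Q - a D_x⁻¹(v D_x Q)) / (p + a)`, `Q = E_v(h)`.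
In order: the formula for every differential function `G = D_x⁻¹(v D_x Q)`; such a `G` exists if `h`
does not depend explicitly on `x`; for `a = 0` the term with `D_x⁻¹` is absent; in general the
formula holds with `D_x⁻¹(v D_x Q)` a potential `w`. -/
theorem mainTheorem9 (U : Set Jet) (a b c p q : ℝ) (h : Jet → ℝ)
    (𝓗 : (Jet → ℝ) → (Jet → ℝ) → Prop) (P : Jet → ℝ)
    (hsys : Jet.IsScalingHamiltonianEq U a b c p q h 𝓗 P) (hpa : p + a ≠ 0) :
    (∀ G : Jet → ℝ,
      Jet.IsAntideriv U (fun z => z.2 0 * Jet.totalDeriv (Jet.euler h) z) G →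
      Jet.EquivMod U h
        (fun z => 1 / (p + a) * ((c + a) * (z.2 0 * Jet.euler h z) - a * G z))) ∧
    ((∀ z ∈ U, Jet.partialX h z = 0) →
      ∃ G : Jet → ℝ,
        Jet.IsAntideriv U (fun z => z.2 0 * Jet.totalDeriv (Jet.euler h) z) G) ∧
    (a = 0 → Jet.EquivMod U h (fun z => 1 / p * (c * (z.2 0 * Jet.euler h z)))) ∧
    Jet.EquivModPot U (fun z => z.2 0 * Jet.totalDeriv (Jet.euler h) z)
      (fun y => h y.1)
      (fun y => 1 / (p + a) *
        ((c + a) * (y.1.2 0 * Jet.euler h y.1) - a * y.2)) := by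
  have hU := hsys.isOpen
  have hh := hsys.density
  obtain ⟨Φ, hΦ, hD⟩ := hh.isTotalDeriv_of_isHomogeneous hU hsys.density_weight
  have hx := Jet.isDiffFun_x U
  refine ⟨fun G hG => ?_, hh.exists_isAntideriv_of_partialX_eq_zero hU, fun ha => ?_, ?_⟩
  · have hxG := (hx.mul hG.1).const_mul a
    -- `D_x(x G) = G + x v D_x Q` trades the remainder in `Φ` for `G`.
    refine ⟨fun z => 1 / (p + a) * (Φ z + a * (z.1 * G z)), (hΦ.add hxG).const_mul _,
      fun z hz => ?_⟩
    rw [Jet.totalDeriv_const_mul hU _ (hΦ.add hxG) hz, Jet.totalDeriv_add hU hΦ hxG hz,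
      Jet.totalDeriv_const_mul hU a (hx.mul hG.1) hz, Jet.totalDeriv_mul hU hx hG.1 hz,
      Jet.totalDeriv_x hU hz, hG.2 z hz, ← hD z hz]
    field_simp
    ring
  · subst ha
    rw [add_zero] at hpa
    refine ⟨fun z => 1 / p * Φ z, hΦ.const_mul _, fun z hz => ?_⟩
    rw [Jet.totalDeriv_const_mul hU _ hΦ hz, ← hD z hz]
    field_simp
    ring
  -- The same witness with `w` for `G`: the `w`-derivative of `x w` supplies `x v D_x Q`.
  · refine ⟨fun y => 1 / (p + a) * (Φ y.1 + a * (y.2 * y.1.1)), ?_, fun z hz w => ?_⟩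
    · obtain ⟨k, F, hF, hFΦ⟩ := hΦ
      refine ⟨k, fun y => 1 / (p + a) * (F y.1 + a * (y.2 * y.1.1)), ?_,
        fun z hz w => by simp only [hFΦ z hz, Jet.trunc]⟩
      exact contDiffOn_const.mul
        ((hF.comp contDiffOn_fst fun _ hy => hy.1).add (by fun_prop))
    · have hw := (hx.const_mul w).const_mul a
      have hderiv : HasDerivAt (fun s : ℝ => 1 / (p + a) * (Φ z + a * (s * z.1)))
          (1 / (p + a) * (a * (1 * z.1))) w :=
        ((((hasDerivAt_id w).mul_const z.1).const_mul a).const_add (Φ z)).const_mul _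
      simp only [Jet.totalDerivPot]
      rw [hderiv.deriv, Jet.totalDeriv_const_mul hU _ (hΦ.add hw) hz,
        Jet.totalDeriv_add hU hΦ hw hz, Jet.totalDeriv_const_mul hU a (hx.const_mul w) hz,
        Jet.totalDeriv_const_mul hU w hx hz, Jet.totalDeriv_x hU hz, ← hD z hz]
      field_simp
      ring
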